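/- Let $W$ be a Coxeter group with generating set $S$ (possibly infinite), identity $e$, length function $\ell$ and Bruhat order $\le$. For $w\in W$ let $[e,w]=\{u\in W: u\le w\}$. For $J\subseteq S$ let $W_J$ be the subgroup generated by $J$, and let $W^J$ be the set of minimal length representatives of the cosets $xW_J$, $x\in W$. Let $w\in W$ and $J\subseteq S$. Every lower interval $[e,y]$, $y\in W$, is finite, so that the Poincaré polynomial $$P_y(t)=\sum_{u\le y}t^{\ell(u)}$$ is defined. For every $x\in[e,w]\cap W^J$ the set $[e,w]\cap xW_J$ has a maximum $q$ in the Bruhat order; put $m_J(w,x)=x^{-1}q$. Then $$P_w(t)=\sum_{x\in[e,w]\cap W^J}t^{\ell(x)}\,P_{m_J(w,x)}(t).$$ In particular, if $w=vu$ with $v\in W^J$, $u\in W_J$, $\ell(w)=\ell(v)+\ell(u)$ and $u=m_J(w,e)$ (a Billey–Postnikov decomposition), then $$P_w(t)=P^J_v(t)\cdot P_u(t),\qquad\text{where } P^J_v(t)=\sum_{x\in[e,v]\cap W^J}t^{\ell(x)}.$$ -/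

import Mathlib

namespace CoxeterSystem

variable {B W : Type*} [Group W] {M : CoxeterMatrix B} (cs : CoxeterSystem M W)

/-- One step up in the Bruhat order: `b = a * t` for a reflection `t`, with `ℓ a < ℓ b`. -/
def BruhatStep (a b : W) : Prop :=
  ∃ t : W, cs.IsReflection t ∧ b = a * t ∧ cs.length a < cs.length b

/-- The Bruhat order: the reflexive transitive closure of `BruhatStep`. -/
def BruhatLE (u w : W) : Prop :=
  Relation.ReflTransGen cs.BruhatStep u w

theorem BruhatLE.eq_or_length_lt {u w : W} (h : cs.BruhatLE u w) :
    u = w ∨ cs.length u < cs.length w := by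
  induction h with
  | refl => exact Or.inl rfl
  | tail _ hstep ih =>
    obtain ⟨t, -, -, hlt⟩ := hstep
    rcases ih with rfl | ih
    · exact Or.inr hlt
    · exact Or.inr (ih.trans hlt)

/-- The Bruhat order as a partial order on `W`. -/
abbrev bruhatOrder : PartialOrder W where
  le := cs.BruhatLE
  le_refl _ := Relation.ReflTransGen.refl
  le_trans _ _ _ h₁ h₂ := Relation.ReflTransGen.trans h₁ h₂
  le_antisymm a b h₁ h₂ := by
    rcases BruhatLE.eq_or_length_lt cs h₁ with h | h
    · exact h
    · rcases BruhatLE.eq_or_length_lt cs h₂ with h' | h'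
      · exact h'.symm
      · exact absurd h (Nat.lt_asymm h')

/-- The lower Bruhat interval `[e, w] = {u | u ≤ w}`. -/
def lowerInterval (w : W) : Set W :=
  {u | cs.BruhatLE u w}

/-- The standard parabolic subgroup `W_J`, generated by the simple reflections in `J`. -/
def parabolic (J : Set B) : Subgroup W :=
  Subgroup.closure (cs.simple '' J)

/-- The set `W^J` of minimal length representatives of the cosets `x W_J`. -/
def minCosetReps (J : Set B) : Set W :=
  {x | ∀ a ∈ cs.parabolic J, cs.length x ≤ cs.length (x * a)}

/-- The coset `x W_J`. -/
def parabolicCoset (J : Set B) (x : W) : Set W :=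
  (fun a => x * a) '' (cs.parabolic J : Set W)

/-- `q` is the maximum, in the Bruhat order, of `[e, w] ∩ x W_J`. -/
def IsCosetMax (J : Set B) (w x q : W) : Prop :=
  @IsGreatest W cs.bruhatOrder.toLE (cs.lowerInterval w ∩ cs.parabolicCoset J x) q

/-- `m_J(w, x) = x⁻¹ q`, where `q` is the maximum of `[e, w] ∩ x W_J`
(meaningful only if this maximum exists). -/
noncomputable def cosetMaxShift (J : Set B) (w x : W) : W :=
  x⁻¹ * Classical.epsilon (cs.IsCosetMax J w x)

/-- The polynomial `∑_{u ∈ A} t ^ ℓ(u)` of a (finite) subset `A` of `W`. -/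
noncomputable def lengthPolynomial (A : Set W) : Polynomial ℤ :=
  ∑ᶠ u ∈ A, Polynomial.X ^ cs.length u

/-- The Poincaré polynomial `P_w(t) = ∑_{u ≤ w} t ^ ℓ(u)`. -/
noncomputable def poincare (w : W) : Polynomial ℤ :=
  cs.lengthPolynomial (cs.lowerInterval w)

/-- The relative Poincaré polynomial `P^J_v(t) = ∑_{x ∈ [e, v] ∩ W^J} t ^ ℓ(x)`. -/
noncomputable def relPoincare (J : Set B) (v : W) : Polynomial ℤ :=
  cs.lengthPolynomial (cs.lowerInterval v ∩ cs.minCosetReps J)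

/-- `w = v u` is the parabolic decomposition of `w` with respect to `J`. -/
def IsParabolicDecomp (J : Set B) (w v u : W) : Prop :=
  w = v * u ∧ v ∈ cs.minCosetReps J ∧ u ∈ cs.parabolic J ∧
    cs.length w = cs.length v + cs.length u

/-- A Billey–Postnikov decomposition: a parabolic decomposition `w = v u` in which `u` is
the maximum of `[e, w] ∩ W_J`, that is `u = m_J(w, e)`. -/
def IsBPDecomp (J : Set B) (w v u : W) : Prop :=
  cs.IsParabolicDecomp J w v u ∧ u = cs.cosetMaxShift J w 1

end CoxeterSystem

/-!
The proof rests on the parity cocycle of a Coxeter system. The group acts on `W × ZMod 2` in such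
a way that the second component counts, modulo `2`, how often a reflection `t` occurs in the right
inversion sequence of a word. This count depends only on the product `w` of the word, and it is
odd exactly when `t` is a right inversion of `w`. This yields the strong exchange property
`mem_rightInvSeq_of_length_lt`, by which `W_J` contains the right inversions of its elements, and
the cocycle identity becomes `length_mul_mul_lt_iff`, which describes the right inversions of a
product.

The cocycle gives the lifting property of the Bruhat order: if `i` is a left descent of `w`, then
`u ≤ w` iff `u ≤ s i * w` or `s i * u ≤ s i * w` (`bruhatLE_iff_of_isLeftDescent`). Induction on
the length of `w` along left descents then shows that lower intervals are finite
(`finite_lowerInterval`) and that each coset `x W_J` meeting `[e, w]` has a maximum there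
(`exists_isCosetMax`): either `s i` preserves the coset, or `i` is a left descent of all elements
of the coset or of none.

For `x ∈ W^J`, left translation by `x` is an isomorphism of ordered sets from `W_J` to `x W_J`
(`mul_bruhatLE_mul_iff`) that adds `ℓ x` to the length, and `W_J` is a lower set. Hence
`[e, w] ∩ x W_J` is the translate of `[e, m_J(w, x)]`, and summation over the cosets gives the
formula. For a Billey–Postnikov decomposition `w = v u`, the elements of `W^J` below `w` are those
below `v`, and `m_J(w, x) = u` for all of them (`cosetMaxShift_eq_of_isBPDecomp`).
-/

namespace CoxeterSystem

variable {B W : Type*} [Group W] {M : CoxeterMatrix B} (cs : CoxeterSystem M W)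

/-! ### The parity cocycle and the exchange property -/

open Classical in
/-- The action of the simple reflection `s i` on `W × ZMod 2`: conjugation on the first
component, while the second one records whether that component equals `s i`. -/
noncomputable def parityStep (i : B) : Function.End (W × ZMod 2) := fun p =>
  (cs.simple i * p.1 * cs.simple i, p.2 + if p.1 = cs.simple i then 1 else 0)

theorem simple_mul_pow_eq (i j : B) (k : ℕ) :
    cs.simple j * (cs.simple i * cs.simple j) ^ k =
      ((cs.simple i * cs.simple j) ^ k)⁻¹ * cs.simple j := by
  have h : SemiconjBy (cs.simple j) (cs.simple i * cs.simple j)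
      (cs.simple i * cs.simple j)⁻¹ := by
    simp [SemiconjBy, mul_assoc]
  rw [(h.pow_right k).eq, inv_pow]

open Classical in
/-- The powers of `s i * s j` act by conjugation and by counting the equalities of `p.1` with the
reflections `s j * (s i * s j) ^ n` of the dihedral group generated by `s i` and `s j`. -/
theorem parityStep_mul_pow (i j : B) (k : ℕ) (p : W × ZMod 2) :
    ((cs.parityStep i * cs.parityStep j) ^ k) p =
      ((cs.simple i * cs.simple j) ^ k * p.1 * ((cs.simple i * cs.simple j) ^ k)⁻¹,
        p.2 + ∑ n ∈ Finset.range (2 * k),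
          if p.1 = cs.simple j * (cs.simple i * cs.simple j) ^ n then 1 else 0) := by
  induction k with
  | zero => simp [Function.End.one_def]
  | succ k ih =>
    have hstep : ((cs.parityStep i * cs.parityStep j) ^ (k + 1)) p = cs.parityStep i
        (cs.parityStep j (((cs.parityStep i * cs.parityStep j) ^ k) p)) := by
      rw [pow_succ']
      rfl
    rw [hstep, ih, show 2 * (k + 1) = 2 * k + 1 + 1 by ring, Finset.sum_range_succ,
      Finset.sum_range_succ, pow_succ' _ k]
    set c := cs.simple i * cs.simple j with hc
    have h₁ : c ^ k * p.1 * (c ^ k)⁻¹ = cs.simple j ↔ p.1 = cs.simple j * c ^ (2 * k) := by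
      rw [two_mul, pow_add, ← mul_assoc, hc, simple_mul_pow_eq, ← hc, mul_inv_eq_iff_eq_mul,
        mul_assoc _ (cs.simple j), eq_inv_mul_iff_mul_eq]
    have h₂ : cs.simple j * (c ^ k * p.1 * (c ^ k)⁻¹) * cs.simple j = cs.simple i ↔
        p.1 = cs.simple j * c ^ (2 * k + 1) := by
      have h₃ : cs.simple j * c ^ (2 * k + 1) =
          (c ^ k)⁻¹ * (cs.simple j * (cs.simple i * cs.simple j)) * c ^ k := by
        rw [← hc, ← mul_assoc, hc, ← simple_mul_pow_eq, ← hc, mul_assoc, mul_assoc, ← pow_succ',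
          ← pow_add]
        congr 2
        ring
      rw [h₃]
      generalize c ^ k = g
      constructor <;> intro h
      · simp [← h, mul_assoc]
      · simp [h, mul_assoc]
    simp only [parityStep, Prod.mk.injEq]
    refine ⟨by simp [hc, mul_assoc], ?_⟩
    simp only [h₁, h₂, add_assoc]

theorem isLiftable_parityStep : M.IsLiftable cs.parityStep := by
  classical
  intro i j
  funext p
  -- `s j * (s i * s j) ^ n` has period `M i j` in `n`, and the sum runs over two periods.
  rw [parityStep_mul_pow, two_mul, Finset.sum_range_add]
  simp [pow_add, CharTwo.add_self_eq_zero, Function.End.one_def]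

/-- The action of `W` on `W × ZMod 2` that extends `parityStep`. -/
noncomputable def parityAction : W →* Function.End (W × ZMod 2) :=
  cs.lift ⟨cs.parityStep, cs.isLiftable_parityStep⟩

/-- The number modulo `2` of occurrences of `t` in the right inversion sequence of a word for
`w`; the definition through `parityAction` makes it independent of the word. -/
noncomputable def inversionParity (w t : W) : ZMod 2 := (cs.parityAction w (t, 0)).2

open Classical in
theorem parityAction_simple (i : B) (p : W × ZMod 2) : cs.parityAction (cs.simple i) p =
    (cs.simple i * p.1 * cs.simple i, p.2 + if p.1 = cs.simple i then 1 else 0) := by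
  rw [parityAction, lift_apply_simple]
  rfl

theorem parityAction_mul (x y : W) (p : W × ZMod 2) :
    cs.parityAction (x * y) p = cs.parityAction x (cs.parityAction y p) := by
  rw [map_mul]
  rfl

theorem parityAction_apply (w : W) (p : W × ZMod 2) :
    cs.parityAction w p = (w * p.1 * w⁻¹, p.2 + cs.inversionParity w p.1) := by
  unfold inversionParity
  induction w using cs.simple_induction_left generalizing p with
  | one => simp [Function.End.one_def]
  | mul_simple_left w i ih =>
    rw [parityAction_mul, parityAction_mul, ih, ih (p.1, 0), parityAction_simple,
      parityAction_simple]
    simp [mul_assoc, add_assoc]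

/-- The cocycle identity. -/
theorem inversionParity_mul (x y t : W) : cs.inversionParity (x * y) t =
    cs.inversionParity y t + cs.inversionParity x (y * t * y⁻¹) := by
  rw [inversionParity, parityAction_mul, parityAction_apply, parityAction_apply]
  simp

open Classical in
theorem inversionParity_simple (i : B) (t : W) :
    cs.inversionParity (cs.simple i) t = if t = cs.simple i then 1 else 0 := by
  simp [inversionParity, parityAction_simple]

theorem inversionParity_one (t : W) : cs.inversionParity 1 t = 0 := by
  simp [inversionParity, Function.End.one_def]

/-- Writing `t` as a conjugate of a simple reflection `s i` by `g`, the contributions of `g` and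
of `g⁻¹` cancel modulo `2`, and `s i` contributes `1`. -/
theorem inversionParity_self {t : W} (ht : cs.IsReflection t) : cs.inversionParity t t = 1 := by
  obtain ⟨g, i, rfl⟩ := ht
  have h := cs.inversionParity_mul g g⁻¹ (g * cs.simple i * g⁻¹)
  rw [mul_inv_cancel, inversionParity_one] at h
  rw [inversionParity_mul, inversionParity_mul]
  simp only [mul_assoc, inv_mul_cancel_left, inv_mul_cancel, mul_one, one_mul, inv_inv, inv_simple,
    simple_mul_simple_self, inversionParity_simple, if_true] at h ⊢
  linear_combination -h

theorem mem_rightInvSeq_of_inversionParity_ne_zero (ω : List B) (t : W)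
    (h : cs.inversionParity (cs.wordProd ω) t ≠ 0) : t ∈ cs.rightInvSeq ω := by
  induction ω with
  | nil => simp [inversionParity_one] at h
  | cons i ω ih =>
    rw [wordProd_cons, inversionParity_mul] at h
    rw [rightInvSeq, List.mem_cons]
    by_cases h' : cs.inversionParity (cs.wordProd ω) t = 0
    · left
      rw [h', inversionParity_simple] at h
      have : cs.wordProd ω * t * (cs.wordProd ω)⁻¹ = cs.simple i := by
        by_contra h''
        simp [h''] at h
      simp [← this, mul_assoc]
    · exact Or.inr (ih h')

/-- The right inversions of `w` are the reflections of odd inversion parity. -/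
theorem inversionParity_eq_one_iff {t : W} (ht : cs.IsReflection t) (w : W) :
    cs.inversionParity w t = 1 ↔ cs.length (w * t) < cs.length w := by
  have key : ∀ w, cs.inversionParity w t ≠ 0 → cs.length (w * t) < cs.length w := by
    intro w h
    obtain ⟨ω, hω, rfl⟩ := cs.exists_isReduced w
    exact (cs.isRightInversion_of_mem_rightInvSeq hω
      (cs.mem_rightInvSeq_of_inversionParity_ne_zero ω t h)).2
  refine ⟨fun h => key w (by simp [h]), fun h => ?_⟩
  by_contra h'
  have h₀ : cs.inversionParity w t = 0 := by
    generalize cs.inversionParity w t = a at h'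
    revert a
    decide
  have := key (w * t) (by
    rw [inversionParity_mul, inversionParity_self _ ht]
    simp [h₀])
  rw [mul_assoc, ht.mul_self, mul_one] at this
  omega

/-- The strong exchange property. -/
theorem mem_rightInvSeq_of_length_lt {t : W} (ht : cs.IsReflection t) (ω : List B)
    (h : cs.length (cs.wordProd ω * t) < cs.length (cs.wordProd ω)) : t ∈ cs.rightInvSeq ω :=
  cs.mem_rightInvSeq_of_inversionParity_ne_zero ω t
    (by simp [(cs.inversionParity_eq_one_iff ht _).2 h])

/-- A reflection `t` is a right inversion of `x * y` iff exactly one of the following holds: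
`t` is one of `y`, or `y * t * y⁻¹` is one of `x`. -/
theorem length_mul_mul_lt_iff {t : W} (ht : cs.IsReflection t) (x y : W) :
    cs.length (x * y * t) < cs.length (x * y) ↔
      Xor (cs.length (y * t) < cs.length y)
        (cs.length (x * (y * t * y⁻¹)) < cs.length x) := by
  rw [← cs.inversionParity_eq_one_iff ht, ← cs.inversionParity_eq_one_iff ht,
    ← cs.inversionParity_eq_one_iff (ht.conj y), inversionParity_mul]
  generalize cs.inversionParity y t = a
  generalize cs.inversionParity x _ = b
  revert a b
  unfold Xor
  decide

/-- If left multiplication by `s i` reverses the comparison of the lengths of `y` and `y * t`,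
then it exchanges the two elements. -/
theorem simple_mul_eq_mul_of_length {t : W} (ht : cs.IsReflection t) (i : B) (y : W)
    (h : ¬ (cs.length (cs.simple i * y * t) < cs.length (cs.simple i * y) ↔
      cs.length (y * t) < cs.length y)) : cs.simple i * y = y * t := by
  have h' : cs.length (cs.simple i * (y * t * y⁻¹)) < cs.length (cs.simple i) := by
    rw [length_mul_mul_lt_iff cs ht] at h
    by_contra h'
    simp only [h', Xor, not_false_eq_true, and_true, false_and, or_false, not_true] at h
  rw [length_simple, Nat.lt_one_iff, length_eq_zero_iff] at h'
  have := eq_inv_of_mul_eq_one_right h'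
  rw [inv_simple] at this
  rw [← this, inv_mul_cancel_right]

/-! ### The lifting property of the Bruhat order -/

variable {cs} in
theorem BruhatStep.bruhatLE {a b : W} (h : cs.BruhatStep a b) : cs.BruhatLE a b :=
  Relation.ReflTransGen.single h

variable {cs} in
theorem BruhatLE.trans {a b c : W} (h : cs.BruhatLE a b) (h' : cs.BruhatLE b c) :
    cs.BruhatLE a c :=
  Relation.ReflTransGen.trans h h'

theorem bruhatLE_refl (a : W) : cs.BruhatLE a a := Relation.ReflTransGen.refl

variable {cs} in
theorem BruhatLE.inv {a b : W} (h : cs.BruhatLE a b) : cs.BruhatLE a⁻¹ b⁻¹ := by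
  induction h with
  | refl => exact cs.bruhatLE_refl _
  | tail _ hstep ih =>
    obtain ⟨t, ht, rfl, hlt⟩ := hstep
    rename_i b _
    refine ih.trans (BruhatStep.bruhatLE ⟨b * t * b⁻¹, ht.conj b, ?_, ?_⟩)
    · simp [mul_assoc, ht.inv]
    · simpa only [length_inv] using hlt

theorem bruhatStep_simple_mul {a : W} {i : B}
    (h : cs.length a < cs.length (cs.simple i * a)) : cs.BruhatStep a (cs.simple i * a) := by
  refine ⟨a⁻¹ * cs.simple i * a, ?_, by simp [← mul_assoc], h⟩
  simpa using (cs.isReflection_simple i).conj a⁻¹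

theorem bruhatLE_of_isLeftDescent {a : W} {i : B} (h : cs.IsLeftDescent a i) :
    cs.BruhatLE (cs.simple i * a) a := by
  have := cs.bruhatStep_simple_mul (a := cs.simple i * a) (i := i) (by simpa using! h)
  simpa using this.bruhatLE

theorem bruhatLE_of_not_isLeftDescent {a : W} {i : B} (h : ¬ cs.IsLeftDescent a i) :
    cs.BruhatLE a (cs.simple i * a) :=
  (cs.bruhatStep_simple_mul (by rw [not_isLeftDescent_iff] at h; omega)).bruhatLE

theorem one_bruhatLE (a : W) : cs.BruhatLE 1 a := by
  induction hn : cs.length a using Nat.strong_induction_on generalizing a with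
  | _ n ih =>
    by_cases ha : a = 1
    · exact ha ▸ cs.bruhatLE_refl _
    · obtain ⟨i, hi⟩ := cs.exists_leftDescent_of_ne_one ha
      exact (ih _ (hn ▸ hi) _ rfl).trans (cs.bruhatLE_of_isLeftDescent hi)

variable {cs} in
/-- Left multiplication by `s i` either collapses a step of the Bruhat order or preserves it. -/
theorem BruhatStep.simple_mul {a b : W} (h : cs.BruhatStep a b) (i : B) :
    cs.simple i * a = b ∨ cs.BruhatStep (cs.simple i * a) (cs.simple i * b) := by
  obtain ⟨t, ht, rfl, hlt⟩ := h
  by_cases hc : cs.length (cs.simple i * a * t) < cs.length (cs.simple i * a)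
  · exact Or.inl (cs.simple_mul_eq_mul_of_length ht i a (by omega))
  · have := ht.length_mul_left_ne (cs.simple i * a)
    exact Or.inr ⟨t, ht, by rw [mul_assoc], by rw [← mul_assoc]; omega⟩

variable {cs} in
/-- Lifting property, for an upper bound of `s i * a`. -/
theorem BruhatLE.simple_mul_le_or {a b : W} (h : cs.BruhatLE a b) (i : B) :
    cs.BruhatLE (cs.simple i * a) b ∨ cs.BruhatLE (cs.simple i * a) (cs.simple i * b) := by
  induction h with
  | refl => exact Or.inr (cs.bruhatLE_refl _)
  | tail _ hstep ih =>
    rcases ih with ih | ih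
    · exact Or.inl (ih.trans hstep.bruhatLE)
    · rcases hstep.simple_mul i with h | h
      · exact Or.inl (h ▸ ih)
      · exact Or.inr (ih.trans h.bruhatLE)

variable {cs} in
/-- Lifting property, for a lower bound of `s i * b`. -/
theorem BruhatLE.le_simple_mul_or {a b : W} (h : cs.BruhatLE a b) (i : B) :
    cs.BruhatLE a (cs.simple i * b) ∨ cs.BruhatLE (cs.simple i * a) (cs.simple i * b) := by
  induction h using Relation.ReflTransGen.head_induction_on with
  | refl => exact Or.inr (cs.bruhatLE_refl _)
  | head hstep _ ih =>
    rcases ih with ih | ih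
    · exact Or.inl (hstep.bruhatLE.trans ih)
    · rcases hstep.simple_mul i with h | h
      · left
        rwa [← h, simple_mul_simple_cancel_left] at ih
      · exact Or.inr (h.bruhatLE.trans ih)

variable {cs} in
theorem BruhatLE.simple_mul_of_isLeftDescent {a b : W} {i : B} (h : cs.BruhatLE a b)
    (ha : cs.IsLeftDescent a i) : cs.BruhatLE (cs.simple i * a) (cs.simple i * b) :=
  (h.le_simple_mul_or i).elim (cs.bruhatLE_of_isLeftDescent ha).trans id

variable {cs} in
theorem BruhatLE.le_simple_mul {a b : W} {i : B} (h : cs.BruhatLE a b)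
    (ha : ¬ cs.IsLeftDescent a i) : cs.BruhatLE a (cs.simple i * b) :=
  (h.le_simple_mul_or i).elim id (cs.bruhatLE_of_not_isLeftDescent ha).trans

variable {cs} in
theorem BruhatLE.simple_mul_of_not_isLeftDescent {a b : W} {i : B} (h : cs.BruhatLE a b)
    (hb : ¬ cs.IsLeftDescent b i) : cs.BruhatLE (cs.simple i * a) (cs.simple i * b) :=
  (h.simple_mul_le_or i).elim (fun h => h.trans (cs.bruhatLE_of_not_isLeftDescent hb)) id

variable {cs} in
theorem BruhatLE.simple_mul_le {a b : W} {i : B} (h : cs.BruhatLE a b)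
    (hb : cs.IsLeftDescent b i) : cs.BruhatLE (cs.simple i * a) b :=
  (h.simple_mul_le_or i).elim id (fun h => h.trans (cs.bruhatLE_of_isLeftDescent hb))

variable {cs} in
theorem BruhatLE.le_mul_simple {a b : W} {i : B} (h : cs.BruhatLE a b)
    (ha : ¬ cs.IsRightDescent a i) : cs.BruhatLE a (b * cs.simple i) := by
  simpa using (h.inv.le_simple_mul (i := i) (by rwa [isLeftDescent_inv_iff])).inv

variable {cs} in
theorem BruhatLE.mul_simple_of_not_isRightDescent {a b : W} {i : B} (h : cs.BruhatLE a b)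
    (hb : ¬ cs.IsRightDescent b i) : cs.BruhatLE (a * cs.simple i) (b * cs.simple i) := by
  simpa using (h.inv.simple_mul_of_not_isLeftDescent (i := i)
    (by rwa [isLeftDescent_inv_iff])).inv

theorem bruhatLE_iff_of_isLeftDescent {a b : W} {i : B} (hb : cs.IsLeftDescent b i) :
    cs.BruhatLE a b ↔
      cs.BruhatLE a (cs.simple i * b) ∨ cs.BruhatLE (cs.simple i * a) (cs.simple i * b) := by
  have hle := cs.bruhatLE_of_isLeftDescent hb
  refine ⟨fun h => h.le_simple_mul_or i, ?_⟩
  rintro (h | h)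
  · exact h.trans hle
  · simpa using (h.trans hle).simple_mul_le hb

theorem bruhatLE_one_iff {a : W} : cs.BruhatLE a 1 ↔ a = 1 := by
  refine ⟨fun h => ?_, fun h => h ▸ cs.bruhatLE_refl _⟩
  rcases BruhatLE.eq_or_length_lt cs h with h | h
  · exact h
  · simp at h

theorem finite_lowerInterval (w : W) : (cs.lowerInterval w).Finite := by
  induction hn : cs.length w using Nat.strong_induction_on generalizing w with
  | _ n ih =>
    by_cases hw : w = 1
    · refine (Set.finite_singleton (1 : W)).subset fun u hu => ?_
      subst hw
      exact cs.bruhatLE_one_iff.1 hu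
    · obtain ⟨i, hi⟩ := cs.exists_leftDescent_of_ne_one hw
      have hfin := ih _ (lt_of_lt_of_eq hi hn) _ rfl
      refine (hfin.union (hfin.image (cs.simple i * ·))).subset fun u hu => ?_
      rcases (cs.bruhatLE_iff_of_isLeftDescent hi).1 hu with h | h
      · exact Or.inl h
      · exact Or.inr ⟨_, h, by simp⟩

/-! ### Parabolic cosets -/

theorem simple_mem_parabolic {J : Set B} {i : B} (hi : i ∈ J) :
    cs.simple i ∈ cs.parabolic J :=
  Subgroup.subset_closure (Set.mem_image_of_mem _ hi)

theorem mem_parabolicCoset_iff {J : Set B} {x y : W} :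
    y ∈ cs.parabolicCoset J x ↔ x⁻¹ * y ∈ cs.parabolic J := by
  constructor
  · rintro ⟨a, ha, rfl⟩
    simpa using ha
  · exact fun h => ⟨_, h, by simp⟩

variable {cs} in
/-- Induction on the elements of a standard parabolic subgroup along right multiplication by
its simple reflections. -/
theorem parabolic_induction_right {J : Set B} {p : (a : W) → a ∈ cs.parabolic J → Prop}
    (one : p 1 (one_mem _))
    (mul_simple : ∀ (a : W) (ha : a ∈ cs.parabolic J) (i : B) (hi : i ∈ J), p a ha →
      p (a * cs.simple i) (mul_mem ha (cs.simple_mem_parabolic hi)))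
    {a : W} (ha : a ∈ cs.parabolic J) : p a ha := by
  unfold parabolic at ha
  induction ha using Subgroup.closure_induction_right with
  | one => exact one
  | mul_right x hx y hy ih =>
    obtain ⟨i, hi, rfl⟩ := hy
    exact mul_simple x hx i hi ih
  | mul_inv_cancel x hx y hy ih =>
    obtain ⟨i, hi, rfl⟩ := hy
    simp only [inv_simple]
    exact mul_simple x hx i hi ih

theorem exists_word_of_mem_parabolic {J : Set B} {a : W} (ha : a ∈ cs.parabolic J) :
    ∃ ω : List B, (∀ i ∈ ω, i ∈ J) ∧ cs.wordProd ω = a := by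
  induction ha using parabolic_induction_right with
  | one => exact ⟨[], by simp⟩
  | mul_simple a _ i hi ih =>
    obtain ⟨ω, hω, rfl⟩ := ih
    exact ⟨ω.concat i, by simpa [or_imp, forall_and] using ⟨hω, hi⟩, cs.wordProd_concat i ω⟩

theorem wordProd_mem_parabolic {J : Set B} {ω : List B} (hω : ∀ i ∈ ω, i ∈ J) :
    cs.wordProd ω ∈ cs.parabolic J := by
  refine Subgroup.list_prod_mem _ fun x hx => ?_
  obtain ⟨i, hi, rfl⟩ := List.mem_map.1 hx
  exact cs.simple_mem_parabolic (hω i hi)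

theorem rightInvSeq_subset_parabolic {J : Set B} {ω : List B} (hω : ∀ i ∈ ω, i ∈ J) {t : W}
    (ht : t ∈ cs.rightInvSeq ω) : t ∈ cs.parabolic J := by
  induction ω with
  | nil => simp at ht
  | cons i ω ih =>
    simp only [List.mem_cons, forall_eq_or_imp] at hω
    rw [rightInvSeq, List.mem_cons] at ht
    rcases ht with rfl | ht
    · have := cs.wordProd_mem_parabolic hω.2
      exact mul_mem (mul_mem (inv_mem this) (cs.simple_mem_parabolic hω.1)) this
    · exact ih hω.2 ht

/-- The right inversions of an element of `W_J` lie in `W_J`. -/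
theorem mem_parabolic_of_length_lt {J : Set B} {a t : W} (ha : a ∈ cs.parabolic J)
    (ht : cs.IsReflection t) (h : cs.length (a * t) < cs.length a) : t ∈ cs.parabolic J := by
  obtain ⟨ω, hω, rfl⟩ := cs.exists_word_of_mem_parabolic ha
  exact cs.rightInvSeq_subset_parabolic hω (cs.mem_rightInvSeq_of_length_lt ht ω h)

variable {cs} in
theorem BruhatStep.mem_parabolic {J : Set B} {a b : W} (h : cs.BruhatStep a b)
    (hb : b ∈ cs.parabolic J) : a ∈ cs.parabolic J ∧ a⁻¹ * b ∈ cs.parabolic J := by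
  obtain ⟨t, ht, rfl, hlt⟩ := h
  have htJ := cs.mem_parabolic_of_length_lt hb ht (by rwa [mul_assoc, ht.mul_self, mul_one])
  exact ⟨by simpa using mul_mem hb (inv_mem htJ), by simpa using htJ⟩

variable {cs} in
theorem BruhatLE.mem_parabolic {J : Set B} {a b : W} (h : cs.BruhatLE a b)
    (hb : b ∈ cs.parabolic J) : a ∈ cs.parabolic J := by
  induction h using Relation.ReflTransGen.head_induction_on with
  | refl => exact hb
  | head hstep _ ih => exact (hstep.mem_parabolic ih).1

/-! ### Minimal coset representatives -/

/-- The length is additive on `W^J × W_J`. -/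
theorem length_mul_of_mem_minCosetReps {J : Set B} {x a : W} (hx : x ∈ cs.minCosetReps J)
    (ha : a ∈ cs.parabolic J) : cs.length (x * a) = cs.length x + cs.length a := by
  induction ha using parabolic_induction_right with
  | one => simp
  | mul_simple a ha i hi ih =>
    have hmem := mul_mem (mul_mem ha (cs.simple_mem_parabolic hi)) (inv_mem ha)
    have hiff := cs.length_mul_mul_lt_iff (cs.isReflection_simple i) x a
    simp only [(hx _ hmem).not_gt, Xor, not_false_eq_true, and_true, false_and, or_false]
      at hiff
    rw [← mul_assoc]
    have h₁ := cs.length_mul_simple a i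
    have h₂ := cs.length_mul_simple (x * a) i
    omega

theorem mem_minCosetReps_of_isLeftDescent {J : Set B} {x : W} {i : B}
    (hx : x ∈ cs.minCosetReps J) (hi : cs.IsLeftDescent x i) :
    cs.simple i * x ∈ cs.minCosetReps J := by
  intro a ha
  have h₁ := cs.length_mul_of_mem_minCosetReps hx ha
  have h₂ := cs.length_simple_mul (x * a) i
  rw [isLeftDescent_iff] at hi
  rw [mul_assoc]
  have h₃ := cs.length_mul_le (cs.simple i * x) a
  rw [mul_assoc] at h₃
  omega

theorem exists_mul_eq_of_minCosetReps (J : Set B) (u : W) :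
    ∃ x ∈ cs.minCosetReps J, ∃ a ∈ cs.parabolic J, x * a = u := by
  obtain ⟨a, ha, hmin⟩ := exists_minimalFor_of_wellFoundedLT (· ∈ cs.parabolic J)
    (fun a => cs.length (u * a)) ⟨1, one_mem _⟩
  refine ⟨u * a, fun b hb => ?_, a⁻¹, inv_mem ha, by simp⟩
  rw [mul_assoc]
  exact (le_total _ _).elim id (hmin (mul_mem ha hb))

theorem eq_one_of_mul_mem_minCosetReps {J : Set B} {x a : W} (hx : x ∈ cs.minCosetReps J)
    (ha : a ∈ cs.parabolic J) (hxa : x * a ∈ cs.minCosetReps J) : a = 1 := by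
  have h₁ := cs.length_mul_of_mem_minCosetReps hx ha
  have h₂ := hxa _ (inv_mem ha)
  rw [mul_inv_cancel_right] at h₂
  exact cs.length_eq_zero_iff.1 (by omega)

theorem not_isRightDescent_of_mem_minCosetReps {J : Set B} {x : W} {i : B}
    (hx : x ∈ cs.minCosetReps J) (hi : cs.simple i ∈ cs.parabolic J) :
    ¬ cs.IsRightDescent x i :=
  (hx _ hi).not_gt

theorem mul_bruhatLE_mul_of_mem_minCosetReps {J : Set B} {x a b : W}
    (hx : x ∈ cs.minCosetReps J) (hb : b ∈ cs.parabolic J) (h : cs.BruhatLE a b) :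
    cs.BruhatLE (x * a) (x * b) := by
  induction h using Relation.ReflTransGen.head_induction_on with
  | refl => exact cs.bruhatLE_refl _
  | head hstep hle ih =>
    have hc := BruhatLE.mem_parabolic hle hb
    have ha := (hstep.mem_parabolic hc).1
    obtain ⟨t, ht, rfl, hlt⟩ := hstep
    refine (BruhatStep.bruhatLE ⟨t, ht, by rw [mul_assoc], ?_⟩).trans ih
    rw [cs.length_mul_of_mem_minCosetReps hx ha, cs.length_mul_of_mem_minCosetReps hx hc]
    omega

/-- Left translation by `x ∈ W^J` identifies `W_J` with `x W_J` as ordered sets. -/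
theorem mul_bruhatLE_mul_iff {J : Set B} {x a b : W} (hx : x ∈ cs.minCosetReps J)
    (ha : a ∈ cs.parabolic J) (hb : b ∈ cs.parabolic J) :
    cs.BruhatLE (x * a) (x * b) ↔ cs.BruhatLE a b := by
  refine ⟨fun h => ?_, cs.mul_bruhatLE_mul_of_mem_minCosetReps hx hb⟩
  induction hn : cs.length x using Nat.strong_induction_on generalizing x with
  | _ n ih =>
    by_cases hx1 : x = 1
    · simpa [hx1] using h
    · obtain ⟨i, hi⟩ := cs.exists_leftDescent_of_ne_one hx1
      have hx' := cs.mem_minCosetReps_of_isLeftDescent hx hi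
      refine ih _ (hn ▸ hi) hx' ?_ rfl
      have hd : cs.IsLeftDescent (x * a) i := by
        have h₁ := cs.length_mul_of_mem_minCosetReps hx ha
        have h₂ := cs.length_mul_of_mem_minCosetReps hx' ha
        rw [isLeftDescent_iff] at hi ⊢
        rw [mul_assoc] at h₂
        omega
      simpa only [mul_assoc] using h.simple_mul_of_isLeftDescent hd

theorem bruhatLE_mul_right {J : Set B} {x a : W} (hx : x ∈ cs.minCosetReps J)
    (ha : a ∈ cs.parabolic J) : cs.BruhatLE x (x * a) := by
  simpa using cs.mul_bruhatLE_mul_of_mem_minCosetReps hx ha (cs.one_bruhatLE a)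

theorem bruhatLE_mul_left {J : Set B} {x a : W} (hx : x ∈ cs.minCosetReps J)
    (ha : a ∈ cs.parabolic J) : cs.BruhatLE a (x * a) := by
  induction hn : cs.length x using Nat.strong_induction_on generalizing x with
  | _ n ih =>
    by_cases hx1 : x = 1
    · simpa [hx1] using cs.bruhatLE_refl a
    · obtain ⟨i, hi⟩ := cs.exists_leftDescent_of_ne_one hx1
      have hx' := cs.mem_minCosetReps_of_isLeftDescent hx hi
      refine (ih _ (hn ▸ hi) hx' rfl).trans ?_
      have h₁ := cs.length_mul_of_mem_minCosetReps hx ha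
      have h₂ := cs.length_mul_of_mem_minCosetReps hx' ha
      rw [mul_assoc] at h₂ ⊢
      refine cs.bruhatLE_of_isLeftDescent ?_
      rw [isLeftDescent_iff] at hi ⊢
      omega

/-! ### The maximum of a coset in a lower interval -/

/-- If left multiplication by `s i` does not preserve the coset `x W_J`, then `i` is a left descent
of all elements of that coset or of none. -/
theorem isLeftDescent_mul_iff {J : Set B} {x a : W} {i : B} (ha : a ∈ cs.parabolic J)
    (hx : x⁻¹ * cs.simple i * x ∉ cs.parabolic J) :
    cs.IsLeftDescent (x * a) i ↔ cs.IsLeftDescent x i := by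
  induction ha using parabolic_induction_right with
  | one => simp
  | mul_simple a ha j hj ih =>
    rw [← ih, ← mul_assoc]
    have hne : cs.simple i * (x * a) ≠ x * a * cs.simple j := by
      intro h
      refine hx ?_
      have h' : x⁻¹ * cs.simple i * x = a * cs.simple j * a⁻¹ := by
        rw [mul_assoc, inv_mul_eq_iff_eq_mul, ← mul_assoc, ← mul_assoc, ← h]
        simp [mul_assoc]
      rw [h']
      exact mul_mem (mul_mem ha (cs.simple_mem_parabolic hj)) (inv_mem ha)
    have hiff := not_imp_comm.1
      (cs.simple_mul_eq_mul_of_length (cs.isReflection_simple j) i (x * a)) hne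
    have h₁ := cs.length_mul_simple (x * a) j
    have h₂ := cs.length_mul_simple (cs.simple i * (x * a)) j
    unfold IsLeftDescent
    rw [← mul_assoc (cs.simple i) (x * a)]
    omega

theorem isCosetMax_iff {J : Set B} {w x q : W} :
    cs.IsCosetMax J w x q ↔ (cs.BruhatLE q w ∧ x⁻¹ * q ∈ cs.parabolic J) ∧
      ∀ u, cs.BruhatLE u w → x⁻¹ * u ∈ cs.parabolic J → cs.BruhatLE u q := by
  simp only [← mem_parabolicCoset_iff]
  exact and_congr Iff.rfl ⟨fun h u h₁ h₂ => h ⟨h₁, h₂⟩, fun h u hu => h u hu.1 hu.2⟩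

variable {cs} in
theorem IsCosetMax.eq {J : Set B} {w x q q' : W} (h : cs.IsCosetMax J w x q)
    (h' : cs.IsCosetMax J w x q') : q = q' :=
  @IsGreatest.unique W cs.bruhatOrder _ _ _ h h'

/-- A coset `x W_J` that meets the lower interval of `w` has a maximum in it. For a left descent
`i` of `w`, the interval is the union of the lower interval of `s i * w` and its left translate by
`s i`; the lifting property carries the maxima over. -/
theorem exists_isCosetMax (J : Set B) {w x u : W} (huw : cs.BruhatLE u w)
    (hux : x⁻¹ * u ∈ cs.parabolic J) : ∃ q, cs.IsCosetMax J w x q := by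
  simp only [isCosetMax_iff]
  induction hn : cs.length w using Nat.strong_induction_on generalizing w x u with
  | _ n ih =>
    by_cases hw : w = 1
    · subst hw
      obtain rfl := cs.bruhatLE_one_iff.1 huw
      exact ⟨1, ⟨huw, hux⟩, fun u hu _ => hu⟩
    obtain ⟨i, hi⟩ := cs.exists_leftDescent_of_ne_one hw
    have hw' := cs.bruhatLE_of_isLeftDescent hi
    have ih' : ∀ {x u : W}, cs.BruhatLE u (cs.simple i * w) → x⁻¹ * u ∈ cs.parabolic J → _ :=
      fun h₁ h₂ => ih _ (lt_of_lt_of_eq hi hn) h₁ h₂ rfl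
    have hiff := fun a => cs.bruhatLE_iff_of_isLeftDescent (a := a) hi
    by_cases hx : x⁻¹ * cs.simple i * x ∈ cs.parabolic J
    · have hcoset : ∀ u, x⁻¹ * u ∈ cs.parabolic J → x⁻¹ * (cs.simple i * u) ∈ cs.parabolic J := by
        intro u hu
        simpa [mul_assoc] using mul_mem hx hu
      obtain ⟨q, ⟨hqw, hqx⟩, hq⟩ := ((hiff u).1 huw).elim (fun h => ih' h hux)
        (fun h => ih' h (hcoset u hux))
      by_cases hqi : cs.IsLeftDescent q i
      · refine ⟨q, ⟨hqw.trans hw', hqx⟩, fun u hu hux => ?_⟩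
        rcases (hiff u).1 hu with h | h
        · exact hq u h hux
        · simpa using (hq _ h (hcoset u hux)).simple_mul_le hqi
      · refine ⟨cs.simple i * q, ⟨(hiff _).2 (Or.inr (by simpa using hqw)), hcoset q hqx⟩,
          fun u hu hux => ?_⟩
        rcases (hiff u).1 hu with h | h
        · exact (hq u h hux).trans (cs.bruhatLE_of_not_isLeftDescent hqi)
        · simpa using (hq _ h (hcoset u hux)).simple_mul_of_not_isLeftDescent hqi
    · have hdesc : ∀ u, x⁻¹ * u ∈ cs.parabolic J →
          (cs.IsLeftDescent u i ↔ cs.IsLeftDescent x i) := by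
        intro u hu
        simpa using cs.isLeftDescent_mul_iff hu hx
      by_cases hxi : cs.IsLeftDescent x i
      · have hcoset : ∀ u, (cs.simple i * x)⁻¹ * (cs.simple i * u) = x⁻¹ * u := by
          simp [mul_assoc]
        obtain ⟨q, ⟨hqw, hqx⟩, hq⟩ := ih' (x := cs.simple i * x) (u := cs.simple i * u)
          (huw.simple_mul_of_isLeftDescent ((hdesc u hux).2 hxi)) (by rwa [hcoset])
        have hqx' : x⁻¹ * (cs.simple i * q) ∈ cs.parabolic J := by
          simpa [mul_assoc] using hqx
        have hqi : ¬ cs.IsLeftDescent q i := by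
          have := (hdesc _ hqx').2 hxi
          rwa [isLeftDescent_iff_not_isLeftDescent_mul, simple_mul_simple_cancel_left] at this
        refine ⟨cs.simple i * q, ⟨(hiff _).2 (Or.inr (by simpa using hqw)), hqx'⟩,
          fun u hu hux => ?_⟩
        have := hq _ (hu.simple_mul_of_isLeftDescent ((hdesc u hux).2 hxi)) (by rwa [hcoset])
        simpa using this.simple_mul_of_not_isLeftDescent hqi
      · obtain ⟨q, ⟨hqw, hqx⟩, hq⟩ :=
          ih' (huw.le_simple_mul (by rwa [hdesc u hux])) hux
        exact ⟨q, ⟨hqw.trans hw', hqx⟩, fun u hu hux =>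
          hq u (hu.le_simple_mul (by rwa [hdesc u hux])) hux⟩

theorem isCosetMax_mul_cosetMaxShift (J : Set B) {w x : W} (hx : cs.BruhatLE x w) :
    cs.IsCosetMax J w x (x * cs.cosetMaxShift J w x) := by
  rw [cosetMaxShift, mul_inv_cancel_left]
  exact Classical.epsilon_spec (cs.exists_isCosetMax J hx (by simp))

theorem cosetMaxShift_mem_parabolic (J : Set B) {w x : W} (hx : cs.BruhatLE x w) :
    cs.cosetMaxShift J w x ∈ cs.parabolic J := by
  simpa using (cs.isCosetMax_iff.1 (cs.isCosetMax_mul_cosetMaxShift J hx)).1.2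

/-! ### The Poincaré polynomial -/

theorem image_lowerInterval_cosetMaxShift {J : Set B} {w x : W} (hxw : cs.BruhatLE x w)
    (hx : x ∈ cs.minCosetReps J) :
    (x * ·) '' cs.lowerInterval (cs.cosetMaxShift J w x) =
      cs.lowerInterval w ∩ cs.parabolicCoset J x := by
  have hm := cs.cosetMaxShift_mem_parabolic J hxw
  obtain ⟨⟨hqw, -⟩, hq⟩ := cs.isCosetMax_iff.1 (cs.isCosetMax_mul_cosetMaxShift J hxw)
  ext u
  constructor
  · rintro ⟨a, ha, rfl⟩
    have haJ := BruhatLE.mem_parabolic ha hm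
    exact ⟨((cs.mul_bruhatLE_mul_iff hx haJ hm).2 ha).trans hqw, a, haJ, rfl⟩
  · rintro ⟨huw, a, haJ, rfl⟩
    exact ⟨a, (cs.mul_bruhatLE_mul_iff hx haJ hm).1 (hq _ huw (by simpa using haJ)), rfl⟩

theorem lengthPolynomial_coset {J : Set B} {w x : W} (hxw : cs.BruhatLE x w)
    (hx : x ∈ cs.minCosetReps J) :
    cs.lengthPolynomial (cs.lowerInterval w ∩ cs.parabolicCoset J x) =
      Polynomial.X ^ cs.length x * cs.poincare (cs.cosetMaxShift J w x) := by
  have hm := cs.cosetMaxShift_mem_parabolic J hxw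
  rw [← cs.image_lowerInterval_cosetMaxShift hxw hx, poincare, lengthPolynomial,
    lengthPolynomial, finsum_mem_image (mul_right_injective x).injOn,
    mul_finsum_mem]
  refine finsum_mem_congr rfl fun a ha => ?_
  rw [cs.length_mul_of_mem_minCosetReps hx (BruhatLE.mem_parabolic ha hm), pow_add]

theorem lowerInterval_eq_biUnion (J : Set B) (w : W) :
    cs.lowerInterval w = ⋃ x ∈ cs.lowerInterval w ∩ cs.minCosetReps J,
      cs.lowerInterval w ∩ cs.parabolicCoset J x := by
  ext u
  simp only [Set.mem_iUnion, exists_prop]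
  constructor
  · intro hu
    obtain ⟨x, hx, a, ha, rfl⟩ := cs.exists_mul_eq_of_minCosetReps J u
    exact ⟨x, ⟨(cs.bruhatLE_mul_right hx ha).trans hu, hx⟩, hu, a, ha, rfl⟩
  · rintro ⟨x, -, hu, -⟩
    exact hu

theorem pairwiseDisjoint_parabolicCoset (J : Set B) (w : W) :
    (cs.lowerInterval w ∩ cs.minCosetReps J).PairwiseDisjoint
      (fun x => cs.lowerInterval w ∩ cs.parabolicCoset J x) := by
  rintro x ⟨-, hx⟩ y ⟨-, hy⟩ hne
  refine Set.disjoint_left.2 fun u hux huy => hne ?_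
  have h₁ := cs.mem_parabolicCoset_iff.1 hux.2
  have h₂ := cs.mem_parabolicCoset_iff.1 huy.2
  have h : x⁻¹ * y ∈ cs.parabolic J := by simpa using mul_mem h₁ (inv_mem h₂)
  exact inv_mul_eq_one.1 (cs.eq_one_of_mul_mem_minCosetReps hx h (by simpa using hy))

theorem poincare_eq_finsum (J : Set B) (w : W) :
    cs.poincare w = ∑ᶠ x ∈ cs.lowerInterval w ∩ cs.minCosetReps J,
      Polynomial.X ^ cs.length x * cs.poincare (cs.cosetMaxShift J w x) := by
  have hfin := cs.finite_lowerInterval w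
  conv_lhs => rw [poincare, lengthPolynomial, cs.lowerInterval_eq_biUnion J w,
    finsum_mem_biUnion (cs.pairwiseDisjoint_parabolicCoset J w) (hfin.inter_of_left _)
      (fun x _ => hfin.inter_of_left _)]
  exact finsum_mem_congr rfl fun x hx => cs.lengthPolynomial_coset hx.1 hx.2

/-! ### Billey–Postnikov decompositions -/

theorem mul_bruhatLE_mul_right {J : Set B} {x v u : W} (hv : v ∈ cs.minCosetReps J)
    (hu : u ∈ cs.parabolic J) (h : cs.BruhatLE x v) : cs.BruhatLE (x * u) (v * u) := by
  induction hn : cs.length u using Nat.strong_induction_on generalizing u with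
  | _ n ih =>
    by_cases hu1 : u = 1
    · simpa [hu1] using h
    obtain ⟨i, hi⟩ := cs.exists_rightDescent_of_ne_one hu1
    -- No reduced word in `J` is needed: `s i` lies in `W_J` as a right inversion of `u ∈ W_J`.
    have hiJ := cs.mem_parabolic_of_length_lt hu (cs.isReflection_simple i) hi
    have hu' := mul_mem hu hiJ
    have hd : ¬ cs.IsRightDescent (v * (u * cs.simple i)) i := by
      have h₁ := cs.length_mul_of_mem_minCosetReps hv hu
      have h₂ := cs.length_mul_of_mem_minCosetReps hv hu'
      rw [isRightDescent_iff] at hi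
      rw [not_isRightDescent_iff, mul_assoc, simple_mul_simple_cancel_right]
      omega
    simpa [mul_assoc] using
      (ih _ (lt_of_lt_of_eq hi hn) hu' rfl).mul_simple_of_not_isRightDescent hd

theorem bruhatLE_of_bruhatLE_mul {J : Set B} {x v u : W} (hx : x ∈ cs.minCosetReps J)
    (hu : u ∈ cs.parabolic J) (h : cs.BruhatLE x (v * u)) : cs.BruhatLE x v := by
  induction hu using parabolic_induction_right with
  | one => simpa using h
  | mul_simple u hu i hi ih =>
    refine ih ?_
    rw [← mul_assoc] at h
    simpa using h.le_mul_simple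
      (cs.not_isRightDescent_of_mem_minCosetReps hx (cs.simple_mem_parabolic hi))

/-- In a Billey–Postnikov decomposition `w = v * u` the interval below `w` meets every coset
`x W_J`, for `x ∈ W^J` below `v`, in a copy of the interval below `u`. -/
theorem cosetMaxShift_eq_of_isBPDecomp {J : Set B} {w v u x : W} (h : cs.IsBPDecomp J w v u)
    (hx : x ∈ cs.minCosetReps J) (hxv : cs.BruhatLE x v) : cs.cosetMaxShift J w x = u := by
  obtain ⟨⟨rfl, hv, hu, -⟩, hmax⟩ := h
  have hone := cs.isCosetMax_mul_cosetMaxShift J (cs.one_bruhatLE (v * u))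
  rw [← hmax, one_mul, isCosetMax_iff] at hone
  have hxw := hxv.trans (cs.bruhatLE_mul_right hv hu)
  refine mul_left_cancel (IsCosetMax.eq (cs.isCosetMax_mul_cosetMaxShift J hxw) ?_)
  refine cs.isCosetMax_iff.2 ⟨⟨cs.mul_bruhatLE_mul_right hv hu hxv, by simpa⟩, ?_⟩
  intro y hy hyx
  obtain ⟨a, ha, rfl⟩ := cs.mem_parabolicCoset_iff.2 hyx
  -- `a ≤ x * a ≤ w` and `a ∈ W_J`, so that `a` is bounded by the maximum `u` over `W_J`.
  have hau := hone.2 a ((cs.bruhatLE_mul_left hx ha).trans hy) (by simpa using ha)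
  exact cs.mul_bruhatLE_mul_of_mem_minCosetReps hx hu hau

theorem poincare_eq_mul_of_isBPDecomp {J : Set B} {w v u : W} (h : cs.IsBPDecomp J w v u) :
    cs.poincare w = cs.relPoincare J v * cs.poincare u := by
  have hset : cs.lowerInterval w ∩ cs.minCosetReps J =
      cs.lowerInterval v ∩ cs.minCosetReps J := by
    obtain ⟨⟨rfl, hv, hu, -⟩, -⟩ := h
    ext x
    exact and_congr_left fun hx => ⟨cs.bruhatLE_of_bruhatLE_mul hx hu,
      fun hxv => hxv.trans (cs.bruhatLE_mul_right hv hu)⟩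
  rw [poincare_eq_finsum cs J, hset, relPoincare, lengthPolynomial, finsum_mem_mul]
  refine finsum_mem_congr rfl fun x hx => ?_
  rw [cs.cosetMaxShift_eq_of_isBPDecomp h hx.2 hx.1]

end CoxeterSystem

theorem corollary2p3 {B W : Type*} [Group W] {M : CoxeterMatrix B} (cs : CoxeterSystem M W)
    (w : W) (J : Set B) :
    -- all sums are finite, and `m_J(w, x)` is well defined for every `x ∈ [e, w] ∩ W^J`
    (∀ y : W, (cs.lowerInterval y).Finite) ∧
    (∀ x ∈ cs.lowerInterval w ∩ cs.minCosetReps J,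
      cs.IsCosetMax J w x (x * cs.cosetMaxShift J w x)) ∧
    -- the decomposition of the Poincaré polynomial
    cs.poincare w =
      ∑ᶠ x ∈ cs.lowerInterval w ∩ cs.minCosetReps J,
        Polynomial.X ^ cs.length x * cs.poincare (cs.cosetMaxShift J w x) ∧
    -- the special case of a Billey–Postnikov decomposition
    (∀ v u : W, cs.IsBPDecomp J w v u →
      cs.poincare w = cs.relPoincare J v * cs.poincare u) := by
  refine ⟨cs.finite_lowerInterval, fun x hx => cs.isCosetMax_mul_cosetMaxShift J hx.1,
    cs.poincare_eq_finsum J w, fun v u h => cs.poincare_eq_mul_of_isBPDecomp h⟩
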